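/- Let $\Sigma = \{a,b\}$ be an alphabet with two distinct letters. For a word $w \in \Sigma^*$ and a letter $c$, let $|w|_c$ be the number of occurrences of $c$ in $w$; put $\operatorname{perm}(w) = \{u \in \Sigma^* : |u|_c = |w|_c \text{ for all } c \in \Sigma\}$, and for $L \subseteq \Sigma^*$ put $\operatorname{perm}(L) = \bigcup_{w \in L} \operatorname{perm}(w)$. For words $u, v$, let $u \mathbin{\sqcup\!\sqcup} v$ be the set of all words $x_1 y_1 x_2 y_2 \cdots x_n y_n$ with $x_i, y_i \in \Sigma^*$ such that $u = x_1 x_2 \cdots x_n$ and $v = y_1 y_2 \cdots y_n$; for languages put $L_1 \mathbin{\sqcup\!\sqcup} L_2 = \bigcup_{x \in L_1,\, y \in L_2} x \mathbin{\sqcup\!\sqcup} y$. Let $L \subseteq \Sigma^*$ be a regular language. If there exists a word $u \in \Sigma^*$ such that $\operatorname{perm}(u) \mathbin{\sqcup\!\sqcup} \Sigma^* \subseteq \operatorname{perm}(L)$, then $\operatorname{perm}(L)$ is regular. -/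

import Mathlib

namespace CommLang

variable {α : Type*}

/-- The commutative closure `perm(w)` of a word: all words containing every letter exactly as
often as `w` does. -/
def permWord [DecidableEq α] (w : List α) : Language α :=
  {u : List α | ∀ c : α, u.count c = w.count c}

/-- The commutative closure `perm(L)` of a language: the union of the `perm(w)`, `w ∈ L`. -/
def perm [DecidableEq α] (L : Language α) : Language α :=
  {u : List α | ∃ w ∈ L, u ∈ permWord w}

/-- The shuffle of two words: all words `x₁ y₁ x₂ y₂ ⋯ xₙ yₙ` with `u = x₁ x₂ ⋯ xₙ` and
`v = y₁ y₂ ⋯ yₙ`, where the `xᵢ` and `yᵢ` are (possibly empty) words. The list `p` holds the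
pairs `(xᵢ, yᵢ)`. -/
def shuffleWord (u v : List α) : Language α :=
  {w : List α | ∃ p : List (List α × List α),
    u = (p.map Prod.fst).flatten ∧
    v = (p.map Prod.snd).flatten ∧
    w = (p.map fun q => q.1 ++ q.2).flatten}

/-- The shuffle of two languages: the union of the shuffles of their words. -/
def shuffle (L₁ L₂ : Language α) : Language α :=
  {w : List α | ∃ x ∈ L₁, ∃ y ∈ L₂, w ∈ shuffleWord x y}

end CommLang

namespace CommLang

variable {α : Type*} [DecidableEq α]

/-! Membership in `perm L` depends only on the letter counts `(i, j)`, and by hypothesis every pair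
above the counts of `u` belongs. Only finitely many rows and columns remain; each is ultimately
periodic by pigeonhole on sets of reachable states (`exists_period_reachSet`). Periodicity in both
directions leaves finitely many left quotients (`isRegular_of_period`). -/

/-- The states a DFA can reach by reading `i` letters `a` and `j` letters `b`, in any order. -/
def reachSet {σ : Type*} (M : DFA α σ) (a b : α) (i j : ℕ) : Set σ :=
  {s | ∃ w : List α, w.count a = i ∧ w.count b = j ∧ M.eval w = s}

theorem reachSet_swap {σ : Type*} (M : DFA α σ) (a b : α) (i j : ℕ) :
    reachSet M b a j i = reachSet M a b i j := by
  ext s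
  exact ⟨fun ⟨w, h₁, h₂, h₃⟩ => ⟨w, h₂, h₁, h₃⟩, fun ⟨w, h₁, h₂, h₃⟩ => ⟨w, h₂, h₁, h₃⟩⟩

theorem mem_reachSet_succ {σ : Type*} (M : DFA α σ) {a b : α} (hab : a ≠ b)
    (hα : ∀ c : α, c = a ∨ c = b) (i j : ℕ) (s : σ) :
    s ∈ reachSet M a b i (j + 1) ↔
      (∃ t ∈ reachSet M a b i j, M.step t b = s) ∨
        ∃ i', i = i' + 1 ∧ ∃ t ∈ reachSet M a b i' (j + 1), M.step t a = s := by
  constructor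
  · rintro ⟨w, hwa, hwb, rfl⟩
    rcases List.eq_nil_or_concat' w with rfl | ⟨v, c, rfl⟩
    · simp at hwb
    · rcases hα c with rfl | rfl
      · refine Or.inr ⟨v.count c, ?_, M.eval v, ⟨v, rfl, ?_, rfl⟩, ?_⟩
        · simpa using hwa.symm
        · simpa [hab] using hwb
        · simp
      · refine Or.inl ⟨M.eval v, ⟨v, ?_, ?_, rfl⟩, ?_⟩
        · simpa [hab.symm] using hwa
        · simpa using hwb
        · simp
  · rintro (⟨_, ⟨v, rfl, rfl, rfl⟩, rfl⟩ | ⟨i', rfl, _, ⟨v, rfl, hb, rfl⟩, rfl⟩)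
    · exact ⟨v ++ [b], by simp [hab.symm], by simp, by simp⟩
    · exact ⟨v ++ [a], by simp, by simp [hab, hb], by simp⟩

/-- By the last letter read, entry `(i + 1, j + 1)` depends only on `(i + 1, j)` and `(i, j + 1)`;
hence the induction on `i`. -/
theorem reachSet_succ_congr {σ : Type*} (M : DFA α σ) {a b : α} (hab : a ≠ b)
    (hα : ∀ c : α, c = a ∨ c = b) {k m n : ℕ}
    (h : ∀ i < k, reachSet M a b i m = reachSet M a b i n) :
    ∀ i < k, reachSet M a b i (m + 1) = reachSet M a b i (n + 1) := by
  intro i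
  induction i with
  | zero =>
    intro hi
    ext s
    simp only [mem_reachSet_succ M hab hα 0, h 0 hi]
    simp
  | succ i ih =>
    intro hi
    ext s
    simp only [mem_reachSet_succ M hab hα (i + 1), h (i + 1) hi, Nat.add_right_cancel_iff,
      exists_eq_left', ih (by omega)]

/-- The first `k` rows of the table of reachable sets are ultimately periodic, with a common
period. -/
theorem exists_period_reachSet {σ : Type*} [Finite σ] (M : DFA α σ) {a b : α} (hab : a ≠ b)
    (hα : ∀ c : α, c = a ∨ c = b) (k : ℕ) :
    ∃ N P : ℕ, 0 < P ∧ ∀ i < k, ∀ j, N ≤ j →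
      reachSet M a b i (j + P) = reachSet M a b i j := by
  obtain ⟨m, n, hmn, heq⟩ := Finite.exists_ne_map_eq_of_infinite
    fun (j : ℕ) (i : Fin k) => reachSet M a b i j
  wlog hlt : m < n generalizing m n
  · exact this n m hmn.symm heq.symm (by omega)
  refine ⟨m, n - m, by omega, fun i hi j hj => ?_⟩
  have key : ∀ d, ∀ i < k, reachSet M a b i (m + d) = reachSet M a b i (n + d) := by
    intro d
    induction d with
    | zero => exact fun i hi => congrFun heq ⟨i, hi⟩
    | succ d ih => exact reachSet_succ_congr M hab hα ih
  obtain ⟨d, rfl⟩ := Nat.exists_eq_add_of_le hj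
  rw [key d i hi]
  congr 1
  omega

theorem exists_lt_of_period {β : Type*} {f : ℕ → β} {N P : ℕ} (hP : 0 < P)
    (h : ∀ j, N ≤ j → f (j + P) = f j) (n : ℕ) : ∃ n' < N + P, f n = f n' := by
  induction n using Nat.strong_induction_on with
  | _ n ih =>
    by_cases hn : n < N + P
    · exact ⟨n, hn, rfl⟩
    · obtain ⟨n', hn', he⟩ := ih (n - P) (by omega)
      refine ⟨n', hn', ?_⟩
      rw [← he, ← h (n - P) (by omega), Nat.sub_add_cancel (by omega)]

/-- A language defined by an ultimately periodic condition on the numbers of `a`s and of `b`s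
is regular. -/
theorem isRegular_of_period {a b : α} {S : ℕ → ℕ → Prop} {L : Language α}
    (hL : ∀ x, x ∈ L ↔ S (x.count a) (x.count b)) {N P N' P' : ℕ} (hP : 0 < P) (hP' : 0 < P')
    (hrow : ∀ i j, N ≤ j → (S i (j + P) ↔ S i j))
    (hcol : ∀ i j, N' ≤ i → (S (i + P') j ↔ S i j)) : L.IsRegular := by
  -- `φ i j` is the left quotient of `L` by any word with counts `(i, j)`.
  let φ : ℕ → ℕ → Language α := fun i j => {y : List α | S (i + y.count a) (j + y.count b)}
  have hφrow : ∀ j, N ≤ j → (fun i => φ i (j + P)) = fun i => φ i j := by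
    intro j hj
    funext i
    ext y
    change S _ (j + P + y.count b) ↔ S _ (j + y.count b)
    rw [add_right_comm]
    exact hrow _ _ (by omega)
  have hφcol : ∀ i, N' ≤ i → φ (i + P') = φ i := by
    intro i hi
    funext j
    ext y
    change S (i + P' + y.count a) _ ↔ S (i + y.count a) _
    rw [add_right_comm]
    exact hcol _ _ (by omega)
  apply Language.IsRegular.of_finite_range_leftQuotient
  refine (((Set.finite_Iio (N' + P')).prod (Set.finite_Iio (N + P))).image
    fun q : ℕ × ℕ => φ q.1 q.2).subset ?_
  rintro _ ⟨x, rfl⟩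
  obtain ⟨i, hi, hi'⟩ := exists_lt_of_period hP' hφcol (x.count a)
  obtain ⟨j, hj, hj'⟩ := exists_lt_of_period (f := fun j i => φ i j) hP hφrow (x.count b)
  refine ⟨(i, j), ⟨hi, hj⟩, ?_⟩
  change φ i j = _
  rw [← congrFun hj' i, ← hi']
  ext y
  rw [Language.mem_leftQuotient, hL, List.count_append, List.count_append]
  rfl

end CommLang

open CommLang in
theorem mem_perm_accepts_iff {α σ : Type*} [DecidableEq α] (M : DFA α σ) {a b : α}
    (hα : ∀ c : α, c = a ∨ c = b) (x : List α) :
    x ∈ perm M.accepts ↔ ∃ s ∈ M.accept, s ∈ reachSet M a b (x.count a) (x.count b) := by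
  constructor
  · rintro ⟨w, hw, hx⟩
    exact ⟨M.eval w, hw, w, (hx a).symm, (hx b).symm, rfl⟩
  · rintro ⟨_, hs, w, ha, hb, rfl⟩
    refine ⟨w, hs, fun c => ?_⟩
    rcases hα c with rfl | rfl
    · exact ha.symm
    · exact hb.symm

open CommLang in
theorem mem_perm_of_count_le {α : Type*} [DecidableEq α] {a b : α} (hab : a ≠ b)
    (hα : ∀ c : α, c = a ∨ c = b) {L : Language α} {u x : List α}
    (h : shuffle (permWord u) ⊤ ≤ perm L)
    (ha : u.count a ≤ x.count a) (hb : u.count b ≤ x.count b) : x ∈ perm L := by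
  -- `v` pads `u` to the letter counts of `x`.
  let v := List.replicate (x.count a - u.count a) a ++ List.replicate (x.count b - u.count b) b
  obtain ⟨w, hw, huv⟩ : u ++ v ∈ perm L :=
    h ⟨u, fun _ => rfl, v, trivial, [(u, v)], by simp, by simp, by simp⟩
  refine ⟨w, hw, fun c => ?_⟩
  rw [← huv c]
  rcases hα c with rfl | rfl
  · simp [v, List.count_replicate, hab.symm]
    omega
  · simp [v, List.count_replicate, hab]
    omega

theorem mainTheorem7 {α : Type*} [DecidableEq α] (a b : α) (hab : a ≠ b)
    (hα : ∀ c : α, c = a ∨ c = b) (L : Language α) (hL : L.IsRegular)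
    (h : ∃ u : List α, CommLang.shuffle (CommLang.permWord u) (⊤ : Language α) ≤ CommLang.perm L) :
    (CommLang.perm L).IsRegular := by
  obtain ⟨σ, _, M, rfl⟩ := hL
  obtain ⟨u, hu⟩ := h
  let S : ℕ → ℕ → Prop := fun i j => ∃ s ∈ M.accept, s ∈ CommLang.reachSet M a b i j
  have hS := mem_perm_accepts_iff M hα
  have hup : ∀ i j, u.count a ≤ i → u.count b ≤ j → S i j := by
    intro i j hi hj
    have hx := (hS _).1 (mem_perm_of_count_le (x := List.replicate i a ++ List.replicate j b)
      hab hα hu (by simp [List.count_replicate, hab.symm, hi])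
      (by simp [List.count_replicate, hab, hj]))
    simpa [List.count_replicate, hab, hab.symm] using hx
  obtain ⟨N, P, hP, hrow⟩ := CommLang.exists_period_reachSet M hab hα (u.count a)
  obtain ⟨N', P', hP', hcol⟩ := CommLang.exists_period_reachSet M hab.symm
    (fun c => (hα c).symm) (u.count b)
  -- The maxima put every pair outside the periodic strips into the quadrant where `S` always holds.
  refine CommLang.isRegular_of_period (S := S) hS (N := max N (u.count b))
    (N' := max N' (u.count a)) hP hP' (fun i j hj => ?_) fun i j hi => ?_
  · by_cases hi : i < u.count a
    · simp only [S, hrow i hi j (by omega)]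
    · exact iff_of_true (hup _ _ (by omega) (by omega)) (hup _ _ (by omega) (by omega))
  · by_cases hj : j < u.count b
    · have := hcol j hj i (by omega)
      rw [CommLang.reachSet_swap M a b, CommLang.reachSet_swap M a b] at this
      simp only [S, this]
    · exact iff_of_true (hup _ _ (by omega) (by omega)) (hup _ _ (by omega) (by omega))
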